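/- For a nonempty finite set $A$ of integers, let $S(A)=\left\{\sum_{b\in B} b : \emptyset\neq B\subseteq A\right\}$ be the set of all nonempty subset sums of $A$, and let $\theta=\frac{1+\sqrt5}{2}$. Let $k\ge 3$, and let $A=\{a_1,a_2,\ldots,a_k\}$ be a set of $k$ positive integers such that $a_1<a_2<\cdots<a_k$ and $\gcd(a_1,\ldots,a_k)=1$. Then \[ |S(A)| \ge \begin{cases} a_k+\dfrac{k(k-1)}{2} & \text{if } a_k\le 2k-3,\\[2mm] \theta(k+1)-4+\dfrac{k(k-1)}{2} & \text{if } a_k\ge 2k-2. \end{cases} \] -/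

import Mathlib

/-- `subsetSums A` is `S(A) = {∑ b ∈ B, b : ∅ ≠ B ⊆ A}`, the set of all nonempty subset sums
of a finite set `A` of integers. -/
def subsetSums (A : Finset ℤ) : Finset ℤ :=
  (A.powerset.filter (fun B => B.Nonempty)).image (fun B => ∑ b ∈ B, b)

/-! Write Σ for the set of subset sums, empty sum included. Let m = max A, C = A \ {m}, and let B be
the image of C in ℤ/m, so |B| = k - 1. Adjoining m to C creates a new sum in each residue class that
Σ(C) meets, so |Σ(A)| ≥ |Σ(C)| + |Σ(B)|. The order on ℤ gives |Σ(C)| ≥ k(k-1)/2 + 1, so it remains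
to show |Σ(B)| ≥ min(m, 2k-3).

If 2|B| > m, pigeonhole gives Σ(B) = ℤ/m. Otherwise `two_mul_card_le_card_allSums` gives 2|B| - 1 =
2k - 3. Its proof looks at the stabilizer of Σ(B). If it is nontrivial, Σ(B) contains many full
cosets. If it is trivial, induct by deleting an element that costs two sums; when there is none,
each b in B moves exactly one point out of Σ(B), a rigid case settled by
`exits_agree_or_entries_agree`.

Since 2k - 3 ≥ θ(k+1) - 4 for k ≥ 3, both cases follow. -/

open Finset
open scoped Pointwise

/-! ### Subset sums, stabilizers and exit points in abelian groups -/

section SubsetSums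
variable {G : Type*} [AddCommGroup G] [DecidableEq G]

/-- All subset sums of `B`, including the empty one. -/
def allSums (B : Finset G) : Finset G := B.powerset.image (fun C => ∑ b ∈ C, b)

theorem mem_allSums {B : Finset G} {g : G} : g ∈ allSums B ↔ ∃ C ⊆ B, ∑ b ∈ C, b = g := by
  simp [allSums]

theorem zero_mem_allSums (B : Finset G) : (0 : G) ∈ allSums B :=
  mem_allSums.2 ⟨∅, by simp, by simp⟩

theorem mem_allSums_of_mem {B : Finset G} {b : G} (hb : b ∈ B) : b ∈ allSums B :=
  mem_allSums.2 ⟨{b}, by simpa using hb, by simp⟩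

theorem allSums_mono {B C : Finset G} (h : B ⊆ C) : allSums B ⊆ allSums C :=
  image_subset_image (powerset_mono.2 h)

theorem mem_allSums_insert {B : Finset G} {x : G} (hx : x ∉ B) {g : G} :
    g ∈ allSums (insert x B) ↔ g ∈ allSums B ∨ g - x ∈ allSums B := by
  constructor
  · intro h
    obtain ⟨C, hC, rfl⟩ := mem_allSums.1 h
    by_cases hxC : x ∈ C
    · right
      refine mem_allSums.2 ⟨C.erase x, fun c hc => ?_, ?_⟩
      · rw [mem_erase] at hc
        exact (mem_insert.1 (hC hc.2)).resolve_left hc.1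
      · rw [← add_sum_erase C _ hxC]; abel
    · left
      refine mem_allSums.2 ⟨C, fun c hc => ?_, rfl⟩
      exact (mem_insert.1 (hC hc)).resolve_left (fun h => hxC (h ▸ hc))
  · rintro (h | h)
    · exact allSums_mono (subset_insert _ _) h
    · obtain ⟨C, hC, h⟩ := mem_allSums.1 h
      refine mem_allSums.2 ⟨insert x C, insert_subset_insert _ hC, ?_⟩
      rw [sum_insert (fun h => hx (hC h)), h]; abel

theorem mem_allSums_union {B C : Finset G} (h : Disjoint B C) {g : G} :
    g ∈ allSums (B ∪ C) ↔ ∃ u ∈ allSums B, g - u ∈ allSums C := by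
  constructor
  · intro hg
    obtain ⟨D, hD, rfl⟩ := mem_allSums.1 hg
    refine ⟨_, mem_allSums.2 ⟨D ∩ B, inter_subset_right, rfl⟩,
      mem_allSums.2 ⟨D \ B, fun d hd => ?_, ?_⟩⟩
    · rw [mem_sdiff] at hd
      exact (mem_union.1 (hD hd.1)).resolve_left hd.2
    · rw [← sum_inter_add_sum_sdiff D B]; abel
  · rintro ⟨u, hu, hg⟩
    obtain ⟨D, hD, rfl⟩ := mem_allSums.1 hu
    obtain ⟨E, hE, hg⟩ := mem_allSums.1 hg
    refine mem_allSums.2 ⟨D ∪ E, union_subset_union hD hE, ?_⟩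
    rw [sum_union (disjoint_of_subset_left hD (disjoint_of_subset_right hE h)), hg]; abel

theorem add_mem_allSums {B : Finset G} {a b : G} (ha : a ∈ B) (hb : b ∈ B) (hab : a ≠ b) :
    a + b ∈ allSums B :=
  mem_allSums.2 ⟨{a, b}, by intro c; simp; rintro (rfl | rfl) <;> assumption, sum_pair hab⟩

/-- Translations by `x` that preserve the subset sums of a subset preserve those of the set. -/
theorem allSums_stable_of_subset {B C : Finset G} (h : C ⊆ B) {x : G}
    (hx : ∀ g ∈ allSums C, g + x ∈ allSums C) : ∀ g ∈ allSums B, g + x ∈ allSums B := by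
  intro g hg
  rw [← union_sdiff_of_subset h] at hg ⊢
  obtain ⟨u, hu, hg⟩ := (mem_allSums_union disjoint_sdiff).1 hg
  exact (mem_allSums_union disjoint_sdiff).2 ⟨u + x, hx u hu, by simpa using hg⟩

theorem stable_iff_neg {S : Finset G} {x : G} (h : ∀ g ∈ S, g + x ∈ S) : ∀ g ∈ S, g - x ∈ S := by
  intro g hg
  have hS : S.image (· + x) = S := by
    apply eq_of_subset_of_card_le
    · intro y hy
      obtain ⟨s, hs, rfl⟩ := mem_image.1 hy
      exact h s hs
    · rw [card_image_of_injective _ (add_left_injective x)]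
  rw [← hS] at hg
  obtain ⟨s, hs, rfl⟩ := mem_image.1 hg
  simpa using hs

/-- The translations preserving a finite set. -/
def translationStabilizer (S : Finset G) : AddSubgroup G where
  carrier := {x | ∀ g ∈ S, g + x ∈ S}
  zero_mem' := by simp
  add_mem' := by
    intro a b ha hb g hg
    rw [← add_assoc]
    exact hb _ (ha g hg)
  neg_mem' := by
    intro a ha g hg
    rw [← sub_eq_add_neg]
    exact stable_iff_neg ha g hg

theorem mem_translationStabilizer {S : Finset G} {x : G} :
    x ∈ translationStabilizer S ↔ ∀ g ∈ S, g + x ∈ S := Iff.rfl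

theorem sum_sub_mem_allSums {B : Finset G} {g : G} (hg : g ∈ allSums B) :
    ∑ b ∈ B, b - g ∈ allSums B := by
  obtain ⟨C, hC, rfl⟩ := mem_allSums.1 hg
  refine mem_allSums.2 ⟨B \ C, sdiff_subset, ?_⟩
  rw [← sum_sdiff hC]; abel

/-- If only one element leaves `S` under translation by `x`, then only one element leaves
under translation by `-x`. -/
theorem exists_unique_exit_neg {S : Finset G} {x q : G} (hq : q ∈ S) (hqx : q + x ∉ S)
    (h : ∀ s ∈ S, s ≠ q → s + x ∈ S) :
    ∃ r ∈ S, r - x ∉ S ∧ ∀ s ∈ S, s ≠ r → s - x ∈ S := by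
  have hsub : (S.erase q).image (· + x) ⊆ S := by
    intro y hy
    obtain ⟨s, hs, rfl⟩ := mem_image.1 hy
    exact h s (mem_of_mem_erase hs) (ne_of_mem_erase hs)
  have hcard : (S \ (S.erase q).image (· + x)).card = 1 := by
    rw [card_sdiff_of_subset hsub, card_image_of_injective _ (add_left_injective x),
      card_erase_of_mem hq]
    have := card_pos.2 ⟨q, hq⟩
    omega
  obtain ⟨r, hr⟩ := card_eq_one.1 hcard
  have hr' : r ∈ S \ (S.erase q).image (· + x) := by rw [hr]; simp
  rw [mem_sdiff] at hr'
  refine ⟨r, hr'.1, fun hrx => hr'.2 ?_, fun s hs hsr => ?_⟩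
  · refine mem_image.2 ⟨r - x, mem_erase.2 ⟨?_, hrx⟩, by simp⟩
    rintro rfl
    simp [hr'.1] at hqx
  · have : s ∈ (S.erase q).image (· + x) := by
      by_contra hs'
      exact hsr (mem_singleton.1 (hr ▸ mem_sdiff.2 ⟨hs, hs'⟩))
    obtain ⟨t, ht, rfl⟩ := mem_image.1 this
    simpa using mem_of_mem_erase ht

/-- If translation by `x` moves two subset sums out of the set of subset sums, then
removing `x` loses at least two subset sums. -/
theorem card_allSums_erase_add_two_le {B : Finset G} {x q r : G} (hx : x ∈ B)
    (hq : q ∈ allSums B) (hr : r ∈ allSums B) (hqr : q ≠ r)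
    (hqx : q + x ∉ allSums B) (hrx : r + x ∉ allSums B) :
    (allSums (B.erase x)).card + 2 ≤ (allSums B).card := by
  -- A sum that avoids `x` can be extended by `x`, so exit points need `x`.
  have key : ∀ s ∈ allSums B, s + x ∉ allSums B → s ∉ allSums (B.erase x) := by
    intro s _ hsx hs'
    apply hsx
    rw [← insert_erase hx, mem_allSums_insert (notMem_erase _ _)]
    right; simpa using hs'
  have hsub : allSums (B.erase x) ⊆ allSums B \ {q, r} := by
    intro s hs
    have hsB := allSums_mono (erase_subset x B) hs
    rw [mem_sdiff]
    refine ⟨hsB, ?_⟩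
    simp only [mem_insert, mem_singleton]
    rintro (rfl | rfl)
    · exact key _ hsB hqx hs
    · exact key _ hsB hrx hs
  have h1 := card_le_card hsub
  have h2 : ({q, r} : Finset G) ⊆ allSums B := by
    intro s; simp only [mem_insert, mem_singleton]; rintro (rfl | rfl) <;> assumption
  rw [card_sdiff_of_subset h2, card_pair hqr] at h1
  have h3 := card_le_card h2
  rw [card_pair hqr] at h3
  omega

/-- If every `x` in a symmetric set `X`, which meets at least two classes `{x, -x}`, has a
unique exit point `q x` from `S`, then either all exit points agree or all
entry points of the complement `q x + x` agree. -/
theorem exits_agree_or_entries_agree {S : Finset G} {X : Set G} (hX : ∀ x ∈ X, -x ∈ X)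
    (q : G → G) (hq : ∀ x ∈ X, q x ∈ S) (hqx : ∀ x ∈ X, q x + x ∉ S)
    (hu : ∀ x ∈ X, ∀ s ∈ S, s ≠ q x → s + x ∈ S)
    {x y : G} (hx : x ∈ X) (hy : y ∈ X) (hyx : y ≠ x) (hyx' : y ≠ -x) :
    (∀ z ∈ X, q z = q x) ∨ (∀ z ∈ X, q z + z = q x + x) := by
  have hu' : ∀ x ∈ X, ∀ s ∈ S, s + x ∉ S → s = q x := fun x hx s hs h => by
    by_contra h'
    exact h (hu x hx s hs h')
  -- If `q x + y` stays in `S`, so does `q x + y + x`, and translating that by `-y` lands on `q x +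
  -- x`, outside `S`.
  have step : ∀ x ∈ X, ∀ y ∈ X, q x = q y ∨ q x + x = q (-y) + -y := by
    intro x hx y hy
    by_cases h : q x + y ∈ S
    · right
      have h1 : q x + y + x ∈ S := by
        apply hu x hx _ h
        intro h0
        rw [add_eq_left] at h0
        subst h0
        simpa [hq _ hy] using hqx _ hy
      have := hu' (-y) (hX y hy) _ h1 (by
        have := hqx x hx
        rwa [show q x + y + x + -y = q x + x by abel])
      rw [← this]; abel
    · left
      exact hu' y hy _ (hq x hx) h
  have distinct : ∀ x y, q x = q y → q x + x = q y + y → x = y := by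
    intro x y h h'
    rwa [h, add_right_inj] at h'
  have pair : ∀ x ∈ X, ∀ y ∈ X, y ≠ x → y ≠ -x →
      (q y = q x ∧ q (-y) = q x ∧ q (-x) = q x) ∨
      (q y + y = q x + x ∧ q (-y) + -y = q x + x ∧ q (-x) + -x = q x + x) := by
    intro x hx y hy h1 h2
    have e1 := step x hx y hy
    have e2 := step x hx (-y) (hX y hy)
    have e3 := step y hy (-x) (hX x hx)
    have e4 := step y hy x hx
    rw [neg_neg] at e2 e3
    rcases e1 with e | e
    · left
      have ne : q x + x ≠ q y + y := fun h => h1 (distinct x y e h).symm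
      exact ⟨e.symm, (e2.resolve_right ne).symm, (e3.resolve_right ne.symm).symm.trans e.symm⟩
    · right
      have ne : q x ≠ q (-y) := fun h => h2 (by rw [distinct x (-y) h e, neg_neg])
      have e2 := e2.resolve_left ne
      have ne' : q y ≠ q x := fun h => h1 (distinct y x h e2.symm)
      exact ⟨e2.symm, e.symm, (e4.resolve_left ne').symm.trans e2.symm⟩
  rcases pair x hx y hy hyx hyx' with ⟨a, b, c⟩ | ⟨a, b, c⟩
  · left
    intro z hz
    by_cases h1 : z = x
    · rw [h1]
    by_cases h2 : z = -x
    · rw [h2, c]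
    by_cases h3 : z = y
    · rw [h3, a]
    by_cases h4 : z = -y
    · rw [h4, b]
    rcases pair x hx z hz h1 h2 with h | h
    · exact h.1
    rcases pair y hy z hz h3 h4 with h' | h'
    · exact h'.1.trans a
    exact absurd (distinct y x a (h'.1.symm.trans h.1)) hyx
  · right
    intro z hz
    by_cases h1 : z = x
    · rw [h1]
    by_cases h2 : z = -x
    · rw [h2, c]
    by_cases h3 : z = y
    · rw [h3, a]
    by_cases h4 : z = -y
    · rw [h4, b]
    rcases pair x hx z hz h1 h2 with h | h
    · rcases pair y hy z hz h3 h4 with h' | h'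
      · exact absurd (distinct y x (h'.1.symm.trans h.1) a) hyx
      · exact h'.1.trans a
    · exact h.1
-- Each element of `B` outside the stabilizer adds at least one full coset of `H`: if translation by
-- `x` preserved `allSums C + H`, it would preserve `allSums B`.
theorem card_stabilizer_mul_le (B H : Finset G)
    (hH : ∀ x, x ∈ H ↔ x ∈ translationStabilizer (allSums B)) (C : Finset G)
    (hC : C ⊆ B \ H) : H.card * (C.card + 1) ≤ (allSums C + H).card := by
  have add_mem : ∀ Y : Finset G, ∀ y ∈ Y + H, ∀ h ∈ H, y + h ∈ Y + H := by
    intro Y y hy h hh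
    obtain ⟨u, hu, h', hh', rfl⟩ := mem_add.1 hy
    rw [add_assoc]
    exact add_mem_add hu ((hH _).2 (add_mem ((hH _).1 hh') ((hH _).1 hh)))
  have h0 : (0 : G) ∈ H := (hH _).2 (zero_mem _)
  induction C using Finset.induction_on with
  | empty =>
    have : allSums (∅ : Finset G) = {0} := by simp [allSums]
    simp [this]
  | insert x C hx ih =>
    have ih := ih ((subset_insert _ _).trans hC)
    have hxB := mem_sdiff.1 (hC (mem_insert_self _ _))
    have hCB : C ⊆ B := ((subset_insert _ _).trans hC).trans sdiff_subset
    have hex : ∃ y ∈ allSums C + H, y + x ∉ allSums C + H := by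
      by_contra! hc
      apply hxB.2
      rw [hH, mem_translationStabilizer]
      intro g hg
      rw [← union_sdiff_of_subset hCB] at hg
      obtain ⟨u, hu, hv⟩ := (mem_allSums_union disjoint_sdiff).1 hg
      obtain ⟨u', hu', h, hh, he⟩ := mem_add.1 (hc u (by simpa using add_mem_add hu h0))
      have : g + x = u' + (g - u) + h := by
        rw [show g + x = u + x + (g - u) by abel, ← he]; abel
      rw [this]
      apply mem_translationStabilizer.1 ((hH _).1 hh)
      rw [← union_sdiff_of_subset hCB]
      exact (mem_allSums_union disjoint_sdiff).2 ⟨u', hu', by simpa using hv⟩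
    obtain ⟨y, hy, hyx⟩ := hex
    have hdisj : Disjoint (allSums C + H) (H.image (fun h => y + x + h)) := by
      rw [disjoint_right]
      intro z hz hz'
      obtain ⟨h, hh, rfl⟩ := mem_image.1 hz
      apply hyx
      simpa using add_mem _ _ hz' (-h) ((hH _).2 (neg_mem ((hH _).1 hh)))
    have hsub : allSums C + H ∪ H.image (fun h => y + x + h) ⊆ allSums (insert x C) + H := by
      apply union_subset
      · exact add_subset_add_right (allSums_mono (subset_insert _ _))
      · intro z hz
        obtain ⟨h, hh, rfl⟩ := mem_image.1 hz
        apply add_mem _ _ _ _ hh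
        obtain ⟨u, hu, h', hh', rfl⟩ := mem_add.1 hy
        rw [add_right_comm]
        exact add_mem_add ((mem_allSums_insert hx).2 (Or.inr (by simpa using hu))) hh'
    have := card_le_card hsub
    rw [card_union_of_disjoint hdisj, card_image_of_injective _ (add_right_injective _)] at this
    rw [card_insert_of_notMem hx]
    linarith

end SubsetSums

/-! ### Lower bounds in finite cyclic groups -/

section Cyclic
variable {G : Type*} [AddCommGroup G] [DecidableEq G] [Fintype G] [IsAddCyclic G]

theorem card_filter_two_nsmul_eq_le (r : G) : (univ.filter (fun b : G => b + b = r)).card ≤ 2 := by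
  by_cases h : ∃ c : G, c + c = r
  · obtain ⟨c, rfl⟩ := h
    refine le_trans ?_ (IsAddCyclic.card_nsmul_eq_zero_le (α := G) (n := 2) (by norm_num))
    apply card_le_card_of_injOn (fun b => b - c) _ (fun a _ b _ h => sub_left_injective h)
    intro b hb
    simp only [coe_filter, mem_univ, true_and, Set.mem_ofPred_eq] at hb ⊢
    rw [two_nsmul, sub_add_sub_comm, hb, sub_self]
  · have : univ.filter (fun b : G => b + b = r) = ∅ :=
      filter_eq_empty_iff.2 fun b _ hb => h ⟨b, hb⟩
    simp [this]

/-- In a cyclic group, a set `D` occupying more than half of a set `K` containing `D` and `r - D`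
represents `r` as the sum of two distinct elements. -/
theorem exists_distinct_add_eq {K D : Finset G} {r : G} (hD : D ⊆ K)
    (hr : ∀ b ∈ D, r - b ∈ K) (hcard : K.card + 3 ≤ 2 * D.card) :
    ∃ b ∈ D, r - b ∈ D ∧ b ≠ r - b := by
  by_contra! hc
  set D' := D.image (fun b => r - b) with hD'
  have hD'K : D' ⊆ K := by
    intro y hy
    obtain ⟨b, hb, rfl⟩ := mem_image.1 hy
    exact hr b hb
  have hD'c : D'.card = D.card := card_image_of_injective _ (sub_right_injective)
  have h1 := card_le_card (union_subset hD hD'K)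
  have h2 := card_union_add_card_inter D D'
  have h3 : D ∩ D' ⊆ univ.filter (fun b : G => b + b = r) := by
    intro b hb
    obtain ⟨hb, hb'⟩ := mem_inter.1 hb
    obtain ⟨c, hc', rfl⟩ := mem_image.1 hb'
    have := hc _ hb (by simpa using hc')
    simp only [mem_filter, mem_univ, true_and]
    nth_rewrite 1 [this]
    abel
  -- `D` and `r - D` share at least three elements of `K`, but `b + b = r` has at most two
  -- solutions.
  have h4 := (card_le_card h3).trans (card_filter_two_nsmul_eq_le r)
  omega

theorem mem_allSums_of_closed {B K : Finset G} (hB : (0 : G) ∉ B) (hBK : insert 0 B ⊆ K) {r : G}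
    (hr : ∀ b ∈ insert 0 B, r - b ∈ K) (hcard : K.card + 1 ≤ 2 * B.card) : r ∈ allSums B := by
  obtain ⟨b, hb, hb', hne⟩ := exists_distinct_add_eq hBK hr (by rw [card_insert_of_notMem hB]; omega)
  rcases mem_insert.1 hb with rfl | hb
  · rw [sub_zero] at hb' hne
    exact mem_allSums_of_mem ((mem_insert.1 hb').resolve_left hne.symm)
  · rcases mem_insert.1 hb' with h | hb'
    · rw [sub_eq_zero] at h
      exact h ▸ mem_allSums_of_mem hb
    · simpa using add_mem_allSums hb hb' hne

theorem allSums_eq_univ {B : Finset G} (hB : (0 : G) ∉ B) (hcard : Fintype.card G + 1 ≤ 2 * B.card) :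
    allSums B = univ :=
  eq_univ_of_forall fun _ =>
    mem_allSums_of_closed hB (subset_univ _) (fun _ _ => mem_univ _) (by simpa using hcard)

theorem two_mul_card_le_of_aperiodic (B : Finset G) (hB : (0 : G) ∉ B)
    (h : ∀ x, (∀ g ∈ allSums B, g + x ∈ allSums B) → x = 0) :
    2 * B.card ≤ (allSums B).card + 1 := by
  induction hn : B.card generalizing B with
  | zero => omega
  | succ n ih =>
    -- Deleting `x` keeps the stabilizer trivial, since translations preserving the sums of a subset
    -- preserve those of `B`.
    by_cases hdrop : ∃ x ∈ B, ∃ q ∈ allSums B, ∃ r ∈ allSums B, q ≠ r ∧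
        q + x ∉ allSums B ∧ r + x ∉ allSums B
    · obtain ⟨x, hx, q, hq, r, hr, hqr, hqx, hrx⟩ := hdrop
      have h1 := card_allSums_erase_add_two_le hx hq hr hqr hqx hrx
      have h2 := ih (B.erase x) (fun h => hB (mem_of_mem_erase h))
        (fun y hy => h y (allSums_stable_of_subset (erase_subset x B) hy))
        (by rw [card_erase_of_mem hx, hn]; rfl)
      omega
    push Not at hdrop
    set S := allSums B with hS
    have exit : ∀ x ∈ B, ∃ q ∈ S, q + x ∉ S ∧ ∀ s ∈ S, s ≠ q → s + x ∈ S := by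
      intro x hx
      have : ∃ q ∈ S, q + x ∉ S := by
        by_contra! hc
        exact hB (h x hc ▸ hx)
      obtain ⟨q, hq, hqx⟩ := this
      exact ⟨q, hq, hqx, fun s hs hsq => hdrop x hx q hq s hs hsq.symm hqx⟩
    let X : Set G := {x | x ∈ B ∨ -x ∈ B}
    have hX : ∀ x ∈ X, -x ∈ X := by
      rintro x (hx | hx)
      · right; simpa using hx
      · left; exact hx
    have exit' : ∀ x : G, ∃ q, x ∈ X → q ∈ S ∧ q + x ∉ S ∧ ∀ s ∈ S, s ≠ q → s + x ∈ S := by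
      intro x
      by_cases hx : x ∈ X
      · rcases hx with hx' | hx'
        · obtain ⟨q, hq⟩ := exit x hx'
          exact ⟨q, fun _ => hq⟩
        · obtain ⟨q, hq, hqx, hq'⟩ := exit _ hx'
          obtain ⟨r, hr⟩ := exists_unique_exit_neg hq hqx hq'
          simp only [sub_neg_eq_add] at hr
          exact ⟨r, fun _ => hr⟩
      · exact ⟨0, fun h => absurd h hx⟩
    choose q hq using exit'
    obtain ⟨x, hx⟩ := card_pos.1 (by omega : 0 < B.card)
    have h0S : (0 : G) ∈ S := zero_mem_allSums B
    have hBS : ∀ b ∈ B, b ∈ S := fun b hb => mem_allSums_of_mem hb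
    have hinsert : insert 0 B ⊆ S := by
      intro b hb
      rcases mem_insert.1 hb with rfl | hb
      · exact h0S
      · exact hBS b hb
    have hcS := card_le_card hinsert
    rw [card_insert_of_notMem hB] at hcS
    by_cases hy : ∃ y ∈ B, y ≠ x ∧ y ≠ -x
    · obtain ⟨y, hy, hyx, hyx'⟩ := hy
      rcases exits_agree_or_entries_agree hX q (fun x hx => (hq x hx).1)
        (fun x hx => (hq x hx).2.1) (fun x hx => (hq x hx).2.2) (Or.inl hx) (Or.inl hy)
        hyx hyx' with hall | hall
      · exfalso
        -- With a common exit point, `S` without it is stable under `B` and contains 0, hence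
        -- contains every subset sum, including `q x`.
        have stable : ∀ z ∈ X, ∀ s ∈ S.erase (q x), s + z ∈ S.erase (q x) := by
          intro z hz s hs
          obtain ⟨hs1, hs2⟩ := mem_erase.1 hs
          refine mem_erase.2 ⟨fun heq => ?_, (hq z hz).2.2 s hs2 (by rwa [hall z hz])⟩
          apply (hq (-z) (hX z hz)).2.1
          rw [hall _ (hX z hz), ← heq]
          simpa using hs2
        have h0 : q x ≠ 0 := by
          intro h0
          apply (hq x (Or.inl hx)).2.1
          rw [h0, zero_add]
          exact hBS x hx
        have : ∀ C ⊆ B, ∑ c ∈ C, c ∈ S.erase (q x) := by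
          intro C
          induction C using Finset.induction_on with
          | empty => intro _; simpa using ⟨h0.symm, h0S⟩
          | insert c C hc ihC =>
            intro hC
            rw [sum_insert hc, add_comm]
            exact stable c (Or.inl (hC (mem_insert_self _ _))) _
              (ihC ((subset_insert _ _).trans hC))
        obtain ⟨C, hC, hCq⟩ := mem_allSums.1 (hq x (Or.inl hx)).1
        have := this C hC
        rw [hCq] at this
        exact notMem_erase _ _ this
      · by_contra hlt
        -- Here `p - b` lies in `S` for every `b` in `B`; if `S` is small, pigeonhole in `insert p
        -- S` makes `p` a subset sum.
        set p := q x + x with hp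
        have hpS : p ∉ S := (hq x (Or.inl hx)).2.1
        apply hpS
        apply mem_allSums_of_closed hB (hinsert.trans (subset_insert p S))
        · intro b hb
          rcases mem_insert.1 hb with rfl | hb
          · simp
          · apply mem_insert_of_mem
            rw [← hall b (Or.inl hb)]
            simpa using (hq b (Or.inl hb)).1
        · rw [card_insert_of_notMem hpS]
          omega
    · push Not at hy
      have : B ⊆ {x, -x} := by
        intro y hyB
        rw [mem_insert, mem_singleton]
        by_cases h1 : y = x
        · exact Or.inl h1
        · exact Or.inr (hy y hyB h1)
      have := (card_le_card this).trans card_le_two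
      omega

/-- A generating set of nonzero elements occupying at most half of a finite cyclic group has
at least `2 * B.card - 1` subset sums. -/
theorem two_mul_card_le_card_allSums (B : Finset G) (hB : (0 : G) ∉ B)
    (hgen : ∀ H : AddSubgroup G, (∀ b ∈ B, b ∈ H) → H = ⊤) (hcard : 2 * B.card ≤ Fintype.card G) :
    2 * B.card ≤ (allSums B).card + 1 := by
  classical
  set H : Finset G := univ.filter (· ∈ translationStabilizer (allSums B)) with hHdef
  have hH : ∀ x, x ∈ H ↔ x ∈ translationStabilizer (allSums B) := by simp [hHdef]
  have h0 : (0 : G) ∈ H := (hH _).2 (zero_mem _)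
  by_cases htriv : ∀ x ∈ H, x = 0
  · exact two_mul_card_le_of_aperiodic B hB fun x hx => htriv x ((hH x).2 hx)
  push Not at htriv
  obtain ⟨x, hx, hx0⟩ := htriv
  have h2 : 2 ≤ H.card := by
    rw [← card_pair hx0]
    apply card_le_card
    intro z; simp only [mem_insert, mem_singleton]; rintro (rfl | rfl) <;> assumption
  by_cases hsub : B ⊆ H
  · have htop := hgen _ fun b hb => (hH b).1 (hsub hb)
    have : allSums B = univ := eq_univ_of_forall fun g => by
      have : g ∈ translationStabilizer (allSums B) := htop ▸ AddSubgroup.mem_top g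
      simpa using mem_translationStabilizer.1 this 0 (zero_mem_allSums B)
    rw [this, card_univ]
    omega
  have ht : 1 ≤ (B \ H).card := card_pos.2 (sdiff_nonempty.2 hsub)
  have h3 := card_stabilizer_mul_le B H hH _ subset_rfl
  have h4 : allSums (B \ H) + H ⊆ allSums B := by
    intro z hz
    obtain ⟨u, hu, h, hh, rfl⟩ := mem_add.1 hz
    exact mem_translationStabilizer.1 ((hH _).1 hh) _ (allSums_mono sdiff_subset hu)
  have h5 := card_le_card h4
  have h6 : (B ∩ H).card + 1 ≤ H.card := by
    rw [← card_erase_add_one h0]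
    gcongr
    intro b hb
    obtain ⟨hb, hb'⟩ := mem_inter.1 hb
    exact mem_erase.2 ⟨fun h => hB (h ▸ hb), hb'⟩
  have h7 := card_sdiff_add_card_inter B H
  -- With t = |B \ H| ≥ 1 and |H| ≥ 2, (|H| - 2)(t - 1) ≥ 0 gives |H|(t + 1) ≥ 2t + 2(|H| - 1) ≥
  -- 2|B|.
  nlinarith
end Cyclic

/-! ### Lifting to the integers -/

section Integers

theorem card_allSums_ge_of_pos (A : Finset ℤ) (hpos : ∀ a ∈ A, 0 < a) :
    A.card * (A.card + 1) + 2 ≤ 2 * (allSums A).card := by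
  induction A using Finset.induction_on_max with
  | empty => simp [allSums]
  | insert a C ha ih =>
    have haC : a ∉ C := fun h => lt_irrefl _ (ha a h)
    have ih := ih fun c hc => hpos c (mem_insert_of_mem hc)
    have h0 : (0 : ℤ) ∉ C := fun h => lt_irrefl _ (hpos 0 (mem_insert_of_mem h))
    have ha0 := hpos a (mem_insert_self _ _)
    have hle : ∀ g ∈ allSums C, g ≤ ∑ c ∈ C, c := by
      intro g hg
      obtain ⟨D, hD, rfl⟩ := mem_allSums.1 hg
      exact sum_le_sum_of_subset_of_nonneg hD fun c hc _ => (hpos c (mem_insert_of_mem hc)).le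
    -- Omitting one or no element of `C` from the full sum gives |C| + 1 sums above the old maximum,
    -- as `c < a`.
    have hdisj : Disjoint (allSums C) ((insert 0 C).image (fun c => ∑ c ∈ C, c + a - c)) := by
      rw [disjoint_right]
      intro z hz hz'
      obtain ⟨c, hc, rfl⟩ := mem_image.1 hz
      have := hle _ hz'
      rcases mem_insert.1 hc with rfl | hc
      · linarith
      · linarith [ha c hc]
    have hsub : allSums C ∪ (insert 0 C).image (fun c => ∑ c ∈ C, c + a - c) ⊆
        allSums (insert a C) := by
      apply union_subset (allSums_mono (subset_insert _ _))
      intro z hz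
      obtain ⟨c, hc, rfl⟩ := mem_image.1 hz
      rw [mem_allSums_insert haC]
      right
      rw [show ∑ c ∈ C, c + a - c - a = ∑ c ∈ C, c - c by ring]
      apply sum_sub_mem_allSums
      rcases mem_insert.1 hc with rfl | hc
      · exact zero_mem_allSums C
      · exact mem_allSums_of_mem hc
    have := card_le_card hsub
    rw [card_union_of_disjoint hdisj, card_image_of_injective _ sub_right_injective,
      card_insert_of_notMem h0] at this
    rw [card_insert_of_notMem haC]
    nlinarith

theorem allSums_image {G' : Type*} [AddCommGroup G'] [DecidableEq G'] {C : Finset ℤ}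
    (f : ℤ →+ G') (hf : Set.InjOn f C) : allSums (C.image f) = (allSums C).image f := by
  ext g
  simp only [mem_allSums, mem_image]
  constructor
  · rintro ⟨D, hD, rfl⟩
    obtain ⟨E, hE, rfl⟩ := subset_image_iff.1 hD
    refine ⟨_, ⟨E, hE, rfl⟩, ?_⟩
    rw [map_sum, sum_image (hf.mono hE)]
  · rintro ⟨_, ⟨E, hE, rfl⟩, rfl⟩
    refine ⟨E.image f, image_subset_image hE, ?_⟩
    rw [map_sum, sum_image (hf.mono hE)]

/-- Adding a new element `m` to `C` produces at least one new subset sum in each residue class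
modulo `m` met by the subset sums of `C`. -/
theorem card_allSums_add_card_residues_le {C : Finset ℤ} {m : ℕ} (hm : 0 < m) (hmC : (m : ℤ) ∉ C) :
    (allSums C).card + ((allSums C).image (fun z : ℤ => (z : ZMod m))).card ≤
      (allSums (insert (m : ℤ) C)).card := by
  have hsub : allSums C ⊆ allSums (insert (m : ℤ) C) := allSums_mono (subset_insert _ _)
  have h : (allSums C).image (fun z : ℤ => (z : ZMod m)) ⊆
      (allSums (insert (m : ℤ) C) \ allSums C).image (fun z : ℤ => (z : ZMod m)) := by
    intro r hr
    obtain ⟨z, hz, rfl⟩ := mem_image.1 hr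
    -- The largest sum in its class, shifted by `m`, is new.
    obtain ⟨w, hw, hmax⟩ := exists_max_image
      ((allSums C).filter (fun w : ℤ => (w : ZMod m) = (z : ZMod m))) id
      ⟨z, mem_filter.2 ⟨hz, rfl⟩⟩
    obtain ⟨hw, hwz⟩ := mem_filter.1 hw
    refine mem_image.2 ⟨w + m, mem_sdiff.2 ⟨?_, fun h => ?_⟩, by simpa using hwz⟩
    · exact (mem_allSums_insert hmC).2 (Or.inr (by simpa using hw))
    · have := hmax (w + m) (mem_filter.2 ⟨h, by simpa using hwz⟩)
      simp only [id] at this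
      omega
  have h1 := (card_le_card h).trans card_image_le
  rw [card_sdiff_of_subset hsub] at h1
  have := card_le_card hsub
  omega

theorem addSubgroup_eq_top_of_gcd {A : Finset ℤ} (hgcd : A.gcd id = 1) {m : ℕ}
    (H : AddSubgroup (ZMod m)) (h : ∀ a ∈ A, (a : ZMod m) ∈ H) : H = ⊤ := by
  obtain ⟨d, hd⟩ := Int.subgroup_cyclic (H.comap (Int.castAddHom (ZMod m)))
  have hdvd : d ∣ A.gcd id := dvd_gcd fun a ha => by
    have : a ∈ H.comap (Int.castAddHom (ZMod m)) := h a ha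
    rw [hd, AddSubgroup.mem_closure_singleton] at this
    obtain ⟨n, hn⟩ := this
    exact ⟨n, by rw [id, ← hn, smul_eq_mul, mul_comm]⟩
  rw [hgcd] at hdvd
  rw [AddSubgroup.eq_top_iff']
  intro x
  obtain ⟨z, rfl⟩ := ZMod.intCast_surjective x
  have : z ∈ H.comap (Int.castAddHom (ZMod m)) := by
    rw [hd, AddSubgroup.mem_closure_singleton]
    obtain ⟨n, hn⟩ := hdvd.trans (one_dvd z)
    exact ⟨n, by rw [smul_eq_mul, mul_comm, hn]⟩
  exact this

theorem card_subsetSums_add_one {A : Finset ℤ} (hpos : ∀ a ∈ A, 0 < a) :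
    (subsetSums A).card + 1 = (allSums A).card := by
  have h : subsetSums A = (allSums A).erase 0 := by
    ext z
    simp only [subsetSums, mem_image, mem_filter, mem_powerset, mem_erase, mem_allSums]
    constructor
    · rintro ⟨B, ⟨hB, hne⟩, rfl⟩
      exact ⟨(sum_pos (fun b hb => hpos b (hB hb)) hne).ne', B, hB, rfl⟩
    · rintro ⟨hz, B, hB, rfl⟩
      refine ⟨B, ⟨hB, ?_⟩, rfl⟩
      rw [nonempty_iff_ne_empty]
      rintro rfl
      simp at hz
  rw [h, card_erase_add_one (zero_mem_allSums A)]

theorem card_subsetSums_ge {A : Finset ℤ} (hpos : ∀ a ∈ A, 0 < a) (hgcd : A.gcd id = 1)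
    {m : ℕ} (hm : IsGreatest (A : Set ℤ) m) :
    A.card * (A.card - 1) + 2 * min (m : ℤ) (2 * A.card - 3) ≤ 2 * ((subsetSums A).card : ℤ) := by
  have hmA : (m : ℤ) ∈ A := hm.1
  have hm0 : 0 < m := by exact_mod_cast hpos _ hmA
  have : NeZero m := ⟨hm0.ne'⟩
  set C := A.erase (m : ℤ) with hC
  have hCA : insert (m : ℤ) C = A := insert_erase hmA
  have hCpos : ∀ c ∈ C, 0 < c := fun c hc => hpos c (mem_of_mem_erase hc)
  have hClt : ∀ c ∈ C, c < m := fun c hc =>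
    lt_of_le_of_ne (hm.2 (mem_of_mem_erase hc)) (ne_of_mem_erase hc)
  have hinj : Set.InjOn (Int.castAddHom (ZMod m)) C := by
    intro a ha b hb hab
    have : (a : ZMod m) = (b : ZMod m) := hab
    rw [ZMod.intCast_eq_intCast_iff', Int.emod_eq_of_lt (hCpos a ha).le (hClt a ha),
      Int.emod_eq_of_lt (hCpos b hb).le (hClt b hb)] at this
    exact this
  set B := C.image (Int.castAddHom (ZMod m)) with hB
  have hB0 : (0 : ZMod m) ∉ B := by
    intro h
    obtain ⟨c, hc, h⟩ := mem_image.1 h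
    rw [Int.coe_castAddHom, ZMod.intCast_zmod_eq_zero_iff_dvd] at h
    exact absurd (Int.le_of_dvd (hCpos c hc) h) (not_le.2 (hClt c hc))
  have hBC : B.card = C.card := card_image_of_injOn hinj
  have hcard : C.card + 1 = A.card := card_erase_add_one hmA
  have h1 := card_allSums_add_card_residues_le hm0 (notMem_erase (m : ℤ) A)
  have h2 : (allSums C).image (fun z : ℤ => (z : ZMod m)) = allSums B := (allSums_image _ hinj).symm
  rw [h2, hCA, ← card_subsetSums_add_one hpos] at h1
  have h3 := card_allSums_ge_of_pos C hCpos
  have h4 : min (m : ℤ) (2 * A.card - 3) ≤ (allSums B).card := by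
    by_cases hlt : m + 1 ≤ 2 * B.card
    · rw [allSums_eq_univ hB0 (by simpa using hlt), card_univ, ZMod.card]
      exact min_le_left _ _
    · have := two_mul_card_le_card_allSums B hB0 (fun H hH => addSubgroup_eq_top_of_gcd hgcd H
        fun a ha => by
          by_cases ham : a = m
          · simp [ham]
          · exact hH _ (mem_image_of_mem _ (mem_erase.2 ⟨ham, ha⟩)))
        (by rw [ZMod.card]; omega)
      apply (min_le_right _ _).trans
      omega
  rw [← hcard] at h4 ⊢
  push_cast at h4 ⊢
  zify at h1 h3
  nlinarith
end Integers

theorem theorem3p2 (k : ℕ) (hk : 3 ≤ k) (A : Finset ℤ) (hcard : A.card = k)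
    (hpos : ∀ a ∈ A, 0 < a) (hgcd : A.gcd id = 1)
    (ak : ℤ) (hak : IsGreatest (A : Set ℤ) ak) :
    (ak ≤ 2 * (k : ℤ) - 3 →
      (ak : ℝ) + (k : ℝ) * ((k : ℝ) - 1) / 2 ≤ ((subsetSums A).card : ℝ)) ∧
    (2 * (k : ℤ) - 2 ≤ ak →
      Real.goldenRatio * ((k : ℝ) + 1) - 4 + (k : ℝ) * ((k : ℝ) - 1) / 2
        ≤ ((subsetSums A).card : ℝ)) := by
  have hak0 : 0 < ak := hpos ak hak.1
  lift ak to ℕ using hak0.le with m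
  have h := card_subsetSums_ge hpos hgcd hak
  rw [hcard] at h
  constructor
  · intro hle
    rw [min_eq_left hle] at h
    have h' : (k : ℝ) * (k - 1) + 2 * m ≤ 2 * ((subsetSums A).card : ℝ) := by exact_mod_cast h
    push_cast
    linarith
  · intro hge
    rw [min_eq_right (by linarith)] at h
    have h' : (k : ℝ) * (k - 1) + 2 * (2 * k - 3) ≤ 2 * ((subsetSums A).card : ℝ) := by
      exact_mod_cast h
    have hk' : (3 : ℝ) ≤ k := by exact_mod_cast hk
    -- With 7/4 in place of θ, the comparison with 2k - 3 is exactly k ≥ 3.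
    have hθ : Real.goldenRatio ≤ 7 / 4 := by
      have := Real.goldenRatio_sq
      nlinarith [Real.goldenRatio_pos]
    nlinarith
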